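/- **Conventions.** Let $\{0,1\}^*$ be the set of all finite bit strings. A *right ideal* is a set $R\subseteq\{0,1\}^*$ with $R\{0,1\}^*\subseteq R$; it is *finitely generated* if $R=C\{0,1\}^*$ for a finite set $C$, and *essential* if it meets every non-empty right ideal. An *isomorphism* of right ideals is a bijection $\varphi:R_1\to R_2$ with $\varphi(xz)=\varphi(x)z$ for all $x\in R_1$, $z\in\{0,1\}^*$. Every isomorphism between finitely generated essential right ideals has a unique maximal extension to such an isomorphism. The *Thompson group* $G_{2,1}$ consists of all maximally extended isomorphisms between finitely generated essential right ideals of $\{0,1\}^*$; its elements act as partial maps on $\{0,1\}^*$ on the left, and the product is composition followed by maximal extension. For $1\le i<j$, $\tau_{i,j}\in G_{2,1}$ is the element that exchanges the $i$-th and the $j$-th letter of all strings of length at least $j$. An element $w\in G_{2,1}$ *stabilizes* $b\{0,1\}^*$ if it maps every element of $b\{0,1\}^*$ on which it is defined into $b\{0,1\}^*$. A *word* over a subset of $G_{2,1}$ is a finite sequence of letters from that subset and formal inverses of such letters. *Circuits* are combinational circuits made of $\wedge$-, $\vee$-, $\neg$- and fork-gates (where $\wedge$, $\vee$ take two adjacent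 wires) and swappings $\tau_{i,j}$ of two wires; the *size* $|C|$ of a circuit $C$ is the number of its gates, including forks and wire-swappings, plus the number of its input ports and output ports. **Theorem (Representation of permutations by the Thompson group).** Let $\Gamma$ be any finite generating set of the group $G_{2,1}$. There is a constant $c$, depending only on $\Gamma$, such that the following holds. Let $g$ be any permutation of $\{0,1\}^m$, and let $C_g$ and $C_{g^{-1}}$ be minimum-size circuits that compute $g$ and $g^{-1}$, respectively. Then there is a word $W$ over $\Gamma\cup\{\tau_{i,i+1}:1\le i\}$, representing an element $w\in G_{2,1}$, such that: 1. for all $x,y\in\{0,1\}^m$, $w(0x)=0\,g(x)$ and $w^{-1}(0y)=0\,g^{-1}(y)$, where $w^{-1}$ is represented by the free-group inverse $W^{-1}$ of the word $W$; 2. $w$ and $w^{-1}$ both stabilize $0\{0,1\}^*$ and $1\{0,1\}^*$; 3. $|W|=|W^{-1}|\le c\,\bigl(|C_g|^4+|C_{g^{-1}}|^4\bigr)$; 4. every subscript of a transposition letter $\tau_{i,i+1}$ (or its inverse) that occurs in $W$ is at most $\max\{|C_g|^2,|C_{g^{-1}}|^2\}+2$. -/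

import Mathlib

/-! ### Combinational circuits

A bit string is a `List Bool`; `false` is the letter 0 and `true` is the letter 1.
`List.Vector Bool m` is the set of bit strings of length `m`. -/

/-- The operations of a combinational circuit. Positions of wires are counted from 1.
The `and`- and `or`-gates take the wires `i` and `i + 1`; `swap i j` exchanges the wires
`i < j`. -/
inductive Gate : Type
  | and (i : ℕ)
  | or (i : ℕ)
  | not (i : ℕ)
  | fork (i : ℕ)
  | swap (i j : ℕ)

/-- `G.Maps s t`: the operation `G`, applied to wires that carry the bits `s` (from top to
bottom), yields wires that carry the bits `t`. -/
inductive Gate.Maps : Gate → List Bool → List Bool → Prop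
  | and (u v : List Bool) (a b : Bool) :
      Gate.Maps (Gate.and (u.length + 1)) (u ++ a :: b :: v) (u ++ (a && b) :: v)
  | or (u v : List Bool) (a b : Bool) :
      Gate.Maps (Gate.or (u.length + 1)) (u ++ a :: b :: v) (u ++ (a || b) :: v)
  | not (u v : List Bool) (a : Bool) :
      Gate.Maps (Gate.not (u.length + 1)) (u ++ a :: v) (u ++ (!a) :: v)
  | fork (u v : List Bool) (a : Bool) :
      Gate.Maps (Gate.fork (u.length + 1)) (u ++ a :: v) (u ++ a :: a :: v)
  | swap (u v w : List Bool) (a b : Bool) :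
      Gate.Maps (Gate.swap (u.length + 1) (u.length + 1 + v.length + 1))
        (u ++ a :: (v ++ b :: w)) (u ++ b :: (v ++ a :: w))

/-- `GatesMap L s t`: performing the operations in the list `L` one after the other, on wires
that carry `s` at the beginning, yields wires that carry `t` at the end. -/
inductive GatesMap : List Gate → List Bool → List Bool → Prop
  | nil (s : List Bool) : GatesMap [] s s
  | cons {G : Gate} {L : List Gate} {s t r : List Bool} :
      G.Maps s t → GatesMap L t r → GatesMap (G :: L) s r

/-- A combinational circuit with `m` input ports and `n` output ports, given by the list of its
operations, read from the input side to the output side. -/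
structure Circuit (m n : ℕ) : Type where
  gates : List Gate
  total : ∀ x : List.Vector Bool m, ∃ y : List.Vector Bool n,
    GatesMap gates x.toList y.toList

namespace Circuit

variable {m n : ℕ}

/-- The size: the number of gates (with forks and wire-swappings), input ports and output
ports. -/
def size (C : Circuit m n) : ℕ := C.gates.length + m + n

/-- `f` is the input-output function of `C`. -/
def Computes (C : Circuit m n) (f : List.Vector Bool m → List.Vector Bool n) : Prop :=
  ∀ x, GatesMap C.gates x.toList (f x).toList

/-- `C` is a circuit of minimum size for `f`. -/
def IsMinimumFor (C : Circuit m n) (f : List.Vector Bool m → List.Vector Bool n) : Prop :=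
  C.Computes f ∧ ∀ D : Circuit m n, D.Computes f → C.size ≤ D.size

end Circuit

/-! ### Right ideals of the free monoid over {0,1} and their isomorphisms -/

def IsRightIdeal (R : Set (List Bool)) : Prop := ∀ x ∈ R, ∀ z, x ++ z ∈ R

/-- `R` intersects every (non-empty) right ideal. -/
def IsEssential (R : Set (List Bool)) : Prop :=
  ∀ J : Set (List Bool), IsRightIdeal J → J.Nonempty → (R ∩ J).Nonempty

/-- `R` is generated, as a right ideal, by a finite set of strings. -/
def IsFinGenRightIdeal (R : Set (List Bool)) : Prop :=
  ∃ C : Set (List Bool), C.Finite ∧ R = {x | ∃ c ∈ C, ∃ z, x = c ++ z}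

/-- Domain of a partial injective map. -/
def pdom (φ : List Bool ≃. List Bool) : Set (List Bool) := {x | ∃ y, y ∈ φ x}

/-- Image of a partial injective map. -/
def pim (φ : List Bool ≃. List Bool) : Set (List Bool) := {y | ∃ x, y ∈ φ x}

/-- `φ` is an isomorphism between finitely generated essential right ideals. -/
structure IsEssIso (φ : List Bool ≃. List Bool) : Prop where
  map_append : ∀ x y z, y ∈ φ x → y ++ z ∈ φ (x ++ z)
  dom_rightIdeal : IsRightIdeal (pdom φ)
  dom_finGen : IsFinGenRightIdeal (pdom φ)
  dom_essential : IsEssential (pdom φ)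
  im_rightIdeal : IsRightIdeal (pim φ)
  im_finGen : IsFinGenRightIdeal (pim φ)
  im_essential : IsEssential (pim φ)

/-- A finitely generated essential right ideal contains all sufficiently long strings. -/
theorem exists_length_mem {R : Set (List Bool)} (hf : IsFinGenRightIdeal R)
    (he : IsEssential R) : ∃ N, ∀ x : List Bool, N ≤ x.length → x ∈ R := by
  obtain ⟨C, hC, rfl⟩ := hf
  obtain ⟨N, hN⟩ := (hC.image List.length).bddAbove
  refine ⟨N, fun x hx => ?_⟩
  obtain ⟨y, ⟨c, hc, z, rfl⟩, t, ht⟩ := he {y | ∃ t, y = x ++ t}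
    (by rintro _ ⟨t, rfl⟩ z; exact ⟨t ++ z, by simp⟩) ⟨x, [], by simp⟩
  have hl : c.length ≤ x.length := (hN ⟨c, hc, rfl⟩).trans hx
  have hp : c <+: x := List.prefix_of_prefix_length_le ⟨z, rfl⟩ ⟨t, ht.symm⟩ hl
  obtain ⟨s, rfl⟩ := hp
  exact ⟨c, hc, s, rfl⟩

theorem finGen_essential_of_length_mem {R : Set (List Bool)} (hR : IsRightIdeal R) (N : ℕ)
    (hN : ∀ x : List Bool, N ≤ x.length → x ∈ R) :
    IsFinGenRightIdeal R ∧ IsEssential R := by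
  refine ⟨⟨{x | x ∈ R ∧ x.length ≤ N}, (List.finite_length_le Bool N).subset
    fun x hx => hx.2, ?_⟩, ?_⟩
  · ext x
    constructor
    · intro hx
      by_cases h : x.length ≤ N
      · exact ⟨x, ⟨hx, h⟩, [], by simp⟩
      · refine ⟨x.take N, ⟨hN _ ?_, ?_⟩, x.drop N, by simp⟩
        · rw [List.length_take]; omega
        · rw [List.length_take]; omega
    · rintro ⟨c, hc, z, rfl⟩
      exact hR c hc.1 z
  · rintro J hJ ⟨x, hx⟩
    exact ⟨x ++ List.replicate N false, hN _ (by simp), hJ x hx _⟩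

theorem pim_eq_pdom_symm (φ : List Bool ≃. List Bool) : pim φ = pdom φ.symm := by
  ext y
  exact exists_congr fun x => (PEquiv.mem_iff_mem φ).symm

namespace IsEssIso

theorem map_append_symm {φ : List Bool ≃. List Bool}
    (h : ∀ x y z, y ∈ φ x → y ++ z ∈ φ (x ++ z)) (x y z : List Bool) (hy : y ∈ φ.symm x) :
    y ++ z ∈ φ.symm (x ++ z) := by
  rw [PEquiv.mem_iff_mem] at hy ⊢
  exact h _ _ _ hy

theorem isRightIdeal_pdom {φ : List Bool ≃. List Bool}
    (h : ∀ x y z, y ∈ φ x → y ++ z ∈ φ (x ++ z)) : IsRightIdeal (pdom φ) := by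
  rintro x ⟨y, hy⟩ z
  exact ⟨y ++ z, h _ _ _ hy⟩

/-- A criterion in terms of long strings. -/
theorem mk_of_length {φ : List Bool ≃. List Bool}
    (h : ∀ x y z, y ∈ φ x → y ++ z ∈ φ (x ++ z))
    (hd : ∃ N, ∀ x : List Bool, N ≤ x.length → x ∈ pdom φ)
    (hi : ∃ N, ∀ x : List Bool, N ≤ x.length → x ∈ pdom φ.symm) : IsEssIso φ := by
  obtain ⟨N, hN⟩ := hd
  obtain ⟨M, hM⟩ := hi
  have h1 := isRightIdeal_pdom h
  have h2 : IsRightIdeal (pim φ) := by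
    rw [pim_eq_pdom_symm]
    exact isRightIdeal_pdom (map_append_symm h)
  rw [← pim_eq_pdom_symm] at hM
  obtain ⟨h3, h4⟩ := finGen_essential_of_length_mem h1 N hN
  obtain ⟨h5, h6⟩ := finGen_essential_of_length_mem h2 M hM
  exact ⟨h, h1, h3, h4, h2, h5, h6⟩

variable {φ ψ : List Bool ≃. List Bool}

theorem exists_dom (h : IsEssIso φ) : ∃ N, ∀ x : List Bool, N ≤ x.length → x ∈ pdom φ :=
  exists_length_mem h.dom_finGen h.dom_essential

theorem symm (h : IsEssIso φ) : IsEssIso φ.symm := by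
  refine ⟨map_append_symm h.map_append, ?_, ?_, ?_, ?_, ?_, ?_⟩
  · rw [← pim_eq_pdom_symm]; exact h.im_rightIdeal
  · rw [← pim_eq_pdom_symm]; exact h.im_finGen
  · rw [← pim_eq_pdom_symm]; exact h.im_essential
  · rw [pim_eq_pdom_symm]; exact h.dom_rightIdeal
  · rw [pim_eq_pdom_symm]; exact h.dom_finGen
  · rw [pim_eq_pdom_symm]; exact h.dom_essential

theorem exists_dom_trans (h : IsEssIso φ) (k : IsEssIso ψ) :
    ∃ N, ∀ x : List Bool, N ≤ x.length → x ∈ pdom (φ.trans ψ) := by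
  obtain ⟨N, hN⟩ := h.exists_dom
  obtain ⟨M, hM⟩ := k.exists_dom
  refine ⟨N + M, fun x hx => ?_⟩
  obtain ⟨y, hy⟩ := hN (x.take N) (by simp; omega)
  obtain ⟨w, hw⟩ := hM (y ++ x.drop N) (by simp; omega)
  have hy2 := h.map_append _ _ (x.drop N) hy
  rw [List.take_append_drop] at hy2
  exact ⟨w, (PEquiv.mem_trans φ ψ x w).2 ⟨_, hy2, hw⟩⟩

theorem trans (h : IsEssIso φ) (k : IsEssIso ψ) : IsEssIso (φ.trans ψ) := by
  refine mk_of_length ?_ (h.exists_dom_trans k) ?_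
  · intro x y z hy
    obtain ⟨w, hw, hy⟩ := (PEquiv.mem_trans φ ψ x y).1 hy
    exact (PEquiv.mem_trans φ ψ _ _).2
      ⟨_, h.map_append _ _ z hw, k.map_append _ _ z hy⟩
  · exact k.symm.exists_dom_trans h.symm

theorem refl : IsEssIso (PEquiv.refl (List Bool)) := by
  refine mk_of_length ?_ ⟨0, fun x _ => ⟨x, by simp⟩⟩ ⟨0, fun x _ => ⟨x, by simp⟩⟩
  intro x y z hy
  simp_all

end IsEssIso

/-! ### Maximal extensions -/

/-- An isomorphism between finitely generated essential right ideals that has no proper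
extension to such an isomorphism. For partial maps, `φ ≤ ψ` says that `ψ` extends `φ`. -/
def IsMaximalEssIso (φ : List Bool ≃. List Bool) : Prop :=
  IsEssIso φ ∧ ∀ ψ : List Bool ≃. List Bool, IsEssIso ψ → φ ≤ ψ → ψ = φ

/-- `x` is sent to `y` by the maximal extension of `φ`. -/
def MaxExtRel (φ : List Bool ≃. List Bool) (x y : List Bool) : Prop :=
  ∃ N, ∀ z : List Bool, N ≤ z.length → y ++ z ∈ φ (x ++ z)

theorem MaxExtRel.symm {φ : List Bool ≃. List Bool} {x y : List Bool}
    (h : MaxExtRel φ x y) : MaxExtRel φ.symm y x := by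
  obtain ⟨N, hN⟩ := h
  exact ⟨N, fun z hz => (PEquiv.mem_iff_mem φ).2 (hN z hz)⟩

theorem MaxExtRel.unique {φ : List Bool ≃. List Bool} {x y w : List Bool}
    (h : MaxExtRel φ x y) (k : MaxExtRel φ x w) : y = w := by
  obtain ⟨N, hN⟩ := h
  obtain ⟨M, hM⟩ := k
  have h1 := hN (List.replicate (N + M) false) (by simp)
  have h2 := hM (List.replicate (N + M) false) (by simp)
  exact List.append_cancel_right (Option.mem_unique h1 h2)

open Classical in
/-- The maximal extension of `φ`; see `maxExt_greatest` and `maxExt_isMaximal`. -/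
noncomputable def maxExt (φ : List Bool ≃. List Bool) : List Bool ≃. List Bool where
  toFun x := if h : ∃ y, MaxExtRel φ x y then some h.choose else none
  invFun y := if h : ∃ x, MaxExtRel φ.symm y x then some h.choose else none
  inv x y := by
    have key : ∀ (χ : List Bool ≃. List Bool) (s t : List Bool),
        (t ∈ if h : ∃ y, MaxExtRel χ s y then some h.choose else none) ↔ MaxExtRel χ s t := by
      intro χ s t
      split_ifs with h
      · simp only [Option.mem_def, Option.some.injEq]
        constructor
        · rintro rfl
          exact h.choose_spec
        · exact fun k => h.choose_spec.unique k
      · simp only [Option.mem_def, reduceCtorEq, false_iff]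
        exact fun k => h ⟨t, k⟩
    exact (key φ.symm y x).trans
      (Iff.trans ⟨fun h => h.symm, fun h => h.symm⟩ (key φ x y).symm)

theorem mem_maxExt {φ : List Bool ≃. List Bool} {x y : List Bool} :
    y ∈ maxExt φ x ↔ MaxExtRel φ x y := by
  classical
  change (y ∈ if h : ∃ y, MaxExtRel φ x y then some h.choose else none) ↔ _
  split_ifs with h
  · simp only [Option.mem_def, Option.some.injEq]
    constructor
    · rintro rfl
      exact h.choose_spec
    · exact fun k => h.choose_spec.unique k
  · simp only [Option.mem_def, reduceCtorEq, false_iff]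
    exact fun k => h ⟨y, k⟩

theorem mem_maxExt_symm {φ : List Bool ≃. List Bool} {x y : List Bool} :
    y ∈ (maxExt φ).symm x ↔ MaxExtRel φ.symm x y := by
  rw [PEquiv.mem_iff_mem, mem_maxExt]
  exact ⟨fun h => h.symm, fun h => h.symm⟩

theorem le_maxExt {φ : List Bool ≃. List Bool} (h : IsEssIso φ) : φ ≤ maxExt φ :=
  fun x y hy => mem_maxExt.2 ⟨0, fun z _ => h.map_append x y z hy⟩

/-- `maxExt φ` extends every extension of `φ`. -/
theorem maxExt_greatest {φ ψ : List Bool ≃. List Bool} (h : IsEssIso φ) (k : IsEssIso ψ)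
    (hle : φ ≤ ψ) : ψ ≤ maxExt φ := by
  obtain ⟨N, hN⟩ := h.exists_dom
  refine fun x y hy => mem_maxExt.2 ⟨N, fun z hz => ?_⟩
  obtain ⟨w, hw⟩ := hN (x ++ z) (by simp; omega)
  have : w = y ++ z := Option.mem_unique (hle _ _ hw) (k.map_append _ _ z hy)
  rwa [← this]

theorem maxExt_isEssIso {φ : List Bool ≃. List Bool} (h : IsEssIso φ) :
    IsEssIso (maxExt φ) := by
  refine IsEssIso.mk_of_length ?_ ?_ ?_
  · intro x y z hy
    obtain ⟨N, hN⟩ := mem_maxExt.1 hy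
    refine mem_maxExt.2 ⟨N, fun t ht => ?_⟩
    rw [List.append_assoc, List.append_assoc]
    exact hN _ (by simp; omega)
  · obtain ⟨N, hN⟩ := h.exists_dom
    refine ⟨N, fun x hx => ?_⟩
    obtain ⟨y, hy⟩ := hN x hx
    exact ⟨y, le_maxExt h _ _ hy⟩
  · obtain ⟨N, hN⟩ := h.symm.exists_dom
    refine ⟨N, fun x hx => ?_⟩
    obtain ⟨y, hy⟩ := hN x hx
    exact ⟨y, mem_maxExt_symm.2 (mem_maxExt.1 (le_maxExt h.symm _ _ hy))⟩

theorem maxExt_isMaximal {φ : List Bool ≃. List Bool} (h : IsEssIso φ) :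
    IsMaximalEssIso (maxExt φ) :=
  ⟨maxExt_isEssIso h, fun _ k hle =>
    le_antisymm (maxExt_greatest h k ((le_maxExt h).trans hle)) hle⟩

theorem IsMaximalEssIso.eq_maxExt {φ ψ : List Bool ≃. List Bool} (h : IsEssIso φ)
    (k : IsMaximalEssIso ψ) (hle : φ ≤ ψ) : ψ = maxExt φ :=
  (k.2 _ (maxExt_isEssIso h) (maxExt_greatest h k.1 hle)).symm

/-! ### The Thompson group -/

/-- The elements of the Thompson group: the maximally extended isomorphisms between finitely
generated essential right ideals of the set of all bit strings. -/
@[ext]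
structure ThompsonG : Type where
  toPEquiv : List Bool ≃. List Bool
  isMaximal : IsMaximalEssIso toPEquiv

namespace ThompsonG

/-- The element that is represented by an isomorphism which need not be maximal. -/
noncomputable def ofEssIso (φ : List Bool ≃. List Bool) (h : IsEssIso φ) : ThompsonG :=
  ⟨maxExt φ, maxExt_isMaximal h⟩

theorem isEssIso (a : ThompsonG) : IsEssIso a.toPEquiv := a.isMaximal.1

theorem eq_of_le {a b : ThompsonG} (χ : List Bool ≃. List Bool) (h : IsEssIso χ)
    (ha : χ ≤ a.toPEquiv) (hb : χ ≤ b.toPEquiv) : a = b :=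
  ThompsonG.ext ((a.isMaximal.eq_maxExt h ha).trans (b.isMaximal.eq_maxExt h hb).symm)

/-- Composition (functions act on the left) followed by maximal extension. -/
noncomputable instance : Mul ThompsonG :=
  ⟨fun a b => ofEssIso (b.toPEquiv.trans a.toPEquiv) (b.isEssIso.trans a.isEssIso)⟩

noncomputable instance : One ThompsonG :=
  ⟨ofEssIso (PEquiv.refl (List Bool)) IsEssIso.refl⟩

/-- The inverse partial map. -/
instance : Inv ThompsonG :=
  ⟨fun a => ⟨a.toPEquiv.symm, a.isEssIso.symm, fun ψ hψ hle => by
    have hle2 : a.toPEquiv ≤ ψ.symm := fun x y hy =>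
      (PEquiv.mem_iff_mem ψ).2 (hle y x ((PEquiv.mem_iff_mem a.toPEquiv).2 hy))
    rw [← a.isMaximal.2 ψ.symm hψ.symm hle2, PEquiv.symm_symm]⟩⟩

theorem trans_le_mul (a b : ThompsonG) :
    b.toPEquiv.trans a.toPEquiv ≤ (a * b).toPEquiv :=
  le_maxExt (b.isEssIso.trans a.isEssIso)

theorem refl_le_one : PEquiv.refl (List Bool) ≤ (1 : ThompsonG).toPEquiv :=
  le_maxExt IsEssIso.refl

theorem inv_toPEquiv (a : ThompsonG) : (a⁻¹).toPEquiv = a.toPEquiv.symm := rfl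

theorem mul_apply {a b : ThompsonG} {x y z : List Bool} (hy : y ∈ b.toPEquiv x)
    (hz : z ∈ a.toPEquiv y) : z ∈ (a * b).toPEquiv x :=
  trans_le_mul a b x z ((PEquiv.mem_trans _ _ _ _).2 ⟨y, hy, hz⟩)

noncomputable instance : Group ThompsonG :=
  Group.ofLeftAxioms
    (fun a b c => by
      refine eq_of_le (c.toPEquiv.trans (b.toPEquiv.trans a.toPEquiv))
        (c.isEssIso.trans (b.isEssIso.trans a.isEssIso)) ?_ ?_
      · intro x w hw
        obtain ⟨y, hy, hw⟩ := (PEquiv.mem_trans _ _ _ _).1 hw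
        exact mul_apply hy (trans_le_mul _ _ _ _ hw)
      · intro x w hw
        obtain ⟨y, hy, hw⟩ := (PEquiv.mem_trans _ _ _ _).1 hw
        obtain ⟨z, hz, hw⟩ := (PEquiv.mem_trans _ _ _ _).1 hw
        exact mul_apply (mul_apply hy hz) hw)
    (fun a => eq_of_le a.toPEquiv a.isEssIso
      (fun _ y hy => mul_apply hy (refl_le_one y y (by simp))) le_rfl)
    (fun a => eq_of_le (a.toPEquiv.trans a.toPEquiv.symm) (a.isEssIso.trans a.isEssIso.symm)
      (trans_le_mul a⁻¹ a)
      (by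
        intro x w hw
        obtain ⟨y, hy, hw⟩ := (PEquiv.mem_trans _ _ _ _).1 hw
        have hx : w = x :=
          Option.mem_unique hw ((PEquiv.mem_iff_mem a.toPEquiv).2 hy)
        exact refl_le_one x w (by simp [hx])))

end ThompsonG

/-! ### Position transpositions -/

/-- The string `x` with the letters at the positions `i` and `j` exchanged (positions are
counted from 0 here, and both have to be smaller than the length). -/
def swapLetters (i j : ℕ) (x : List Bool) : List Bool :=
  List.ofFn fun k : Fin x.length => x.getD (Equiv.swap i j k) false

@[simp] theorem length_swapLetters (i j : ℕ) (x : List Bool) :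
    (swapLetters i j x).length = x.length := by
  simp [swapLetters]

theorem swap_lt {i j k n : ℕ} (hi : i < n) (hj : j < n) (hk : k < n) :
    Equiv.swap i j k < n := by
  rw [Equiv.swap_apply_def]
  split_ifs <;> assumption

theorem getElem_swapLetters {i j : ℕ} {x : List Bool} {k : ℕ}
    (hk : k < (swapLetters i j x).length) :
    (swapLetters i j x)[k] = x.getD (Equiv.swap i j k) false := by
  simp [swapLetters]

theorem swapLetters_swapLetters {i j : ℕ} {x : List Bool} (hi : i < x.length)
    (hj : j < x.length) : swapLetters i j (swapLetters i j x) = x := by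
  refine List.ext_getElem (by simp) fun k h1 h2 => ?_
  have h3 := swap_lt hi hj h2
  rw [getElem_swapLetters, List.getD_eq_getElem _ _ (by simpa using h3), getElem_swapLetters,
    Equiv.swap_apply_self, List.getD_eq_getElem _ _ h2]

theorem swapLetters_append {i j : ℕ} {x : List Bool} (hi : i < x.length)
    (hj : j < x.length) (z : List Bool) :
    swapLetters i j (x ++ z) = swapLetters i j x ++ z := by
  refine List.ext_getElem (by simp) fun k h1 h2 => ?_
  rw [getElem_swapLetters, List.getElem_append]
  split_ifs with h
  · have h3 : k < x.length := by simpa using h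
    have h4 := swap_lt hi hj h3
    rw [getElem_swapLetters, List.getD_append _ _ _ _ h4]
  · have h3 : x.length ≤ k := by simpa using h
    rw [Equiv.swap_apply_of_ne_of_ne (by omega) (by omega),
      List.getD_eq_getElem _ _ (by simpa using h1), List.getElem_append_right h3]
    simp

/-- The partial map that exchanges the letters number `i` and `j` (counted from 1) of the
strings of length at least `j`. -/
def tauPEquiv (i j : ℕ) (hi : 1 ≤ i) (hij : i < j) : List Bool ≃. List Bool where
  toFun x := if j ≤ x.length then some (swapLetters (i - 1) (j - 1) x) else none
  invFun x := if j ≤ x.length then some (swapLetters (i - 1) (j - 1) x) else none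
  inv x y := by
    have key : ∀ s t : List Bool,
        (t ∈ if j ≤ s.length then some (swapLetters (i - 1) (j - 1) s) else none) →
        (s ∈ if j ≤ t.length then some (swapLetters (i - 1) (j - 1) t) else none) := by
      intro s t h
      split_ifs at h with hs
      · simp only [Option.mem_def, Option.some.injEq] at h
        subst h
        rw [length_swapLetters, if_pos hs,
          swapLetters_swapLetters (by omega) (by omega)]
        rfl
      · simp at h
    exact ⟨key y x, key x y⟩

theorem mem_tauPEquiv {i j : ℕ} {hi : 1 ≤ i} {hij : i < j} {x y : List Bool} :
    y ∈ tauPEquiv i j hi hij x ↔ j ≤ x.length ∧ y = swapLetters (i - 1) (j - 1) x := by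
  change (y ∈ if j ≤ x.length then some (swapLetters (i - 1) (j - 1) x) else none) ↔ _
  split_ifs with h
  · simp [h, eq_comm]
  · simp [h]

theorem tauPEquiv_isEssIso (i j : ℕ) (hi : 1 ≤ i) (hij : i < j) :
    IsEssIso (tauPEquiv i j hi hij) := by
  have hd : ∀ x : List Bool, j ≤ x.length → x ∈ pdom (tauPEquiv i j hi hij) :=
    fun x hx => ⟨_, mem_tauPEquiv.2 ⟨hx, rfl⟩⟩
  refine IsEssIso.mk_of_length ?_ ⟨j, hd⟩ ⟨j, hd⟩
  intro x y z hy
  obtain ⟨hx, rfl⟩ := mem_tauPEquiv.1 hy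
  exact mem_tauPEquiv.2 ⟨by simp; omega, (swapLetters_append (by omega) (by omega) z).symm⟩

/-- The position transposition `τ_{i,j}`, for `1 ≤ i < j`, as an element of the Thompson
group. -/
noncomputable def tau (i j : ℕ) (hi : 1 ≤ i) (hij : i < j) : ThompsonG :=
  ThompsonG.ofEssIso (tauPEquiv i j hi hij) (tauPEquiv_isEssIso i j hi hij)

/-! ### Words over a generating set and the position transpositions -/

/-- The letters of the alphabet `Γ ∪ {τ_{i,i+1} : 1 ≤ i}`. -/
inductive Letter (Γ : Set ThompsonG) : Type
  | gen (γ : Γ)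
  | trans (i : ℕ) (hi : 1 ≤ i)

/-- The element of the group that a letter denotes. -/
noncomputable def Letter.val {Γ : Set ThompsonG} : Letter Γ → ThompsonG
  | Letter.gen γ => γ.1
  | Letter.trans i hi => tau i (i + 1) hi (Nat.lt_succ_self i)

/-- Group words over the alphabet `Γ ∪ {τ_{i,i+1} : 1 ≤ i}`: the pair `(a, true)` stands for
the letter `a`, and `(a, false)` for its inverse. -/
abbrev GroupWord (Γ : Set ThompsonG) : Type := List (Letter Γ × Bool)

/-- The element of the Thompson group that a word represents. -/
noncomputable def GroupWord.value {Γ : Set ThompsonG} (W : GroupWord Γ) : ThompsonG :=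
  FreeGroup.lift Letter.val (FreeGroup.mk W)

/-- `a` stabilizes the right ideal of all strings that begin with the letter `b`. -/
def ThompsonG.Stabilizes (a : ThompsonG) (b : Bool) : Prop :=
  ∀ x y : List Bool, y ∈ a.toPEquiv (b :: x) → ∃ z : List Bool, y = b :: z

/-! ### Membership and group operations in the Thompson group -/

/-! The proof is Bennett's reversible simulation, carried out inside the Thompson group. A bit
string of length `N` is regarded as a memory. The gate that adds `f (M a) (M b)` to the cell `c`,
for distinct `a`, `b`, `c`, is an involution. On the first three cells it is the fixed group element
`xorElt f`; elsewhere it is a conjugate of that element by O(N) adjacent transpositions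
(`Realizes.xorGate`). The element `shiftElt` sends 0z to 00z, so its powers supply zero cells as
workspace and its inverse powers remove them.

A circuit is simulated by letting wires point to cells: forks and swappings only redirect pointers,
and every other gate writes into a fresh zero cell (`exists_gates_simulating`). Computing, copying
the result and computing backwards adds the output to a register and restores everything else
(`exists_gates_xorInto`). The circuit for g thus turns (x, 0) into (x, g(x)). The circuit for the
inverse, applied to g(x), yields x and erases the first register; g(x) is then moved there
(`exists_gates_perm`).

The required word is s⁻ᵏ v sᵏ, where s spells `shiftElt` and v spells these gates. If B is the
larger circuit size, then O(B) gates on B + 1 cells cost O(B) letters each, so the length is O(B²),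
well within the bound.

Stabilization follows from the values on the strings 0x with |x| = m, since these determine w and
its inverse on all longer strings that begin with 0. -/

namespace ThompsonG

theorem mem_inv {a : ThompsonG} {x y : List Bool} :
    y ∈ (a⁻¹).toPEquiv x ↔ x ∈ a.toPEquiv y :=
  PEquiv.mem_iff_mem a.toPEquiv

theorem mem_one (x : List Bool) : x ∈ (1 : ThompsonG).toPEquiv x :=
  refl_le_one x x (by simp)

theorem mem_append {a : ThompsonG} {x y : List Bool} (h : y ∈ a.toPEquiv x) (z : List Bool) :
    y ++ z ∈ a.toPEquiv (x ++ z) :=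
  a.isEssIso.map_append x y z h

theorem mem_pow {a : ThompsonG} {f : ℕ → List Bool}
    (h : ∀ n, f (n + 1) ∈ a.toPEquiv (f n)) (n : ℕ) : f n ∈ (a ^ n).toPEquiv (f 0) := by
  induction n with
  | zero => rw [pow_zero]; exact mem_one _
  | succ n ih => rw [pow_succ']; exact mul_apply ih (h n)

/-! ### Stabilizers of the two halves -/

/-- If all long extensions of `y` begin with `b`, then so does `y`. -/
theorem exists_cons_of_forall_append {b : Bool} {y : List Bool} (m : ℕ)
    (h : ∀ z : List Bool, m ≤ z.length → ∃ t, y ++ z = b :: t) : ∃ t, y = b :: t := by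
  cases y with
  | nil =>
    -- An extension with the wrong first letter excludes the empty string.
    obtain ⟨t, ht⟩ := h ((!b) :: List.replicate m false) (by simp)
    simp at ht
  | cons a y =>
    obtain ⟨t, ht⟩ := h (List.replicate m false) (by simp)
    simp only [List.cons_append, List.cons.injEq] at ht
    exact ⟨y, by rw [ht.1]⟩

theorem exists_mem_cons_of_forall_length {a : ThompsonG} {b : Bool} {m : ℕ}
    (h : ∀ x : List Bool, x.length = m → ∃ y, (b :: y) ∈ a.toPEquiv (b :: x))
    {x y : List Bool} (hx : m ≤ x.length) (hy : y ∈ a.toPEquiv (b :: x)) :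
    ∃ t, y = b :: t := by
  obtain ⟨u, hu⟩ := h (x.take m) (by simp [hx])
  have h1 := mem_append hu (x.drop m)
  rw [List.cons_append, List.take_append_drop] at h1
  exact ⟨u ++ x.drop m, Option.mem_unique hy h1⟩

/-- A maximal extension may also be defined on strings too short for the hypothesis. Appending a
long tail makes the hypothesis applicable, and the first letter of the image is read off from the
extended image. -/
theorem stabilizes_of_forall_length {a : ThompsonG} {b : Bool} {m : ℕ}
    (h : ∀ x : List Bool, x.length = m → ∃ y, (b :: y) ∈ a.toPEquiv (b :: x)) :
    a.Stabilizes b := by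
  intro x y hy
  refine exists_cons_of_forall_append m fun z hz => ?_
  refine exists_mem_cons_of_forall_length h (x := x ++ z) ?_ (mem_append hy z)
  simp only [List.length_append]
  omega

/-- An image with first letter `b` would be sent back by the inverse to a string beginning with `b`.
The extra letter `z` is there because the image `y` might a priori be empty. -/
theorem stabilizes_not_of_stabilizes_inv {a : ThompsonG} {b : Bool}
    (h : (a⁻¹).Stabilizes b) : a.Stabilizes (!b) := by
  intro x y hy
  refine exists_cons_of_forall_append 1 fun z hz => ?_
  have h1 := mem_append hy z
  cases hw : y ++ z with
  | nil => simp at hw; simp [hw.2] at hz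
  | cons c w =>
    by_cases hc : c = b
    · subst hc
      rw [hw, ← mem_inv] at h1
      obtain ⟨t, ht⟩ := h _ _ h1
      simp at ht
    · exact ⟨w, by rw [Bool.eq_not.2 hc]⟩

end ThompsonG

/-! ### Words -/

namespace GroupWord

variable {Γ : Set ThompsonG}

theorem value_append (U V : GroupWord Γ) : value (U ++ V) = value U * value V := by
  unfold value
  rw [← FreeGroup.mul_mk, map_mul]

theorem value_nil : value ([] : GroupWord Γ) = 1 := by
  unfold value
  rw [← FreeGroup.one_eq_mk, map_one]

theorem value_singleton (a : Letter Γ) : value [(a, true)] = a.val := by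
  simp [value]

theorem value_invRev (W : GroupWord Γ) : value (FreeGroup.invRev W) = (value W)⁻¹ := by
  unfold value
  rw [← FreeGroup.inv_mk, map_inv]

theorem value_flatten_replicate (W : GroupWord Γ) (n : ℕ) :
    value (List.replicate n W).flatten = value W ^ n := by
  induction n with
  | zero => simp [value_nil]
  | succ n ih => rw [List.replicate_succ, List.flatten_cons, value_append, ih, pow_succ']

theorem mem_invRev {W : GroupWord Γ} {a : Letter Γ} {e : Bool}
    (h : (a, e) ∈ FreeGroup.invRev W) : (a, !e) ∈ W := by
  simp only [FreeGroup.invRev, List.mem_reverse, List.mem_map, Prod.mk.injEq] at h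
  obtain ⟨⟨a', e'⟩, h1, rfl, rfl⟩ := h
  simpa using h1

/-- Fixed elements are spelled by generators alone, so they contribute nothing to the bound on the
subscripts of transpositions. -/
theorem exists_value_eq (hgen : Subgroup.closure Γ = ⊤) (a : ThompsonG) :
    ∃ W : GroupWord Γ, (∀ i hi e, (Letter.trans i hi, e) ∉ W) ∧ W.value = a := by
  have ha : a ∈ Subgroup.closure Γ := by rw [hgen]; trivial
  induction ha using Subgroup.closure_induction with
  | mem x hx => exact ⟨[(Letter.gen ⟨x, hx⟩, true)], by simp, value_singleton _⟩
  | one => exact ⟨[], by simp, value_nil⟩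
  | mul x y _ _ hx hy =>
    obtain ⟨U, hU, rfl⟩ := hx
    obtain ⟨V, hV, rfl⟩ := hy
    refine ⟨U ++ V, fun i hi e h => ?_, value_append _ _⟩
    rcases List.mem_append.1 h with h | h
    exacts [hU _ _ _ h, hV _ _ _ h]
  | inv x _ hx =>
    obtain ⟨U, hU, rfl⟩ := hx
    exact ⟨FreeGroup.invRev U, fun i hi e h => hU _ _ _ (mem_invRev h), value_invRev _⟩

end GroupWord

/-! ### Two kinds of elements of the Thompson group -/

/-- The prefix substitution `0 ↦ 00`, `10 ↦ 01`, `11 ↦ 1`. -/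
def shiftPEquiv : List Bool ≃. List Bool where
  toFun
    | false :: z => some (false :: false :: z)
    | true :: false :: z => some (false :: true :: z)
    | true :: true :: z => some (true :: z)
    | _ => none
  invFun
    | false :: false :: z => some (false :: z)
    | false :: true :: z => some (true :: false :: z)
    | true :: z => some (true :: true :: z)
    | _ => none
  inv x y := by
    rcases x with _ | ⟨_ | _, _ | ⟨_ | _, x⟩⟩ <;> rcases y with _ | ⟨_ | _, _ | ⟨_ | _, y⟩⟩ <;>
      simp <;> exact eq_comm

theorem shiftPEquiv_isEssIso : IsEssIso shiftPEquiv := by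
  refine IsEssIso.mk_of_length ?_ ⟨2, ?_⟩ ⟨2, ?_⟩
  · intro x y z h
    rcases x with _ | ⟨_ | _, _ | ⟨_ | _, x⟩⟩ <;>
      simp [shiftPEquiv] at h ⊢ <;> subst h <;> rfl
  · intro x hx
    rcases x with _ | ⟨_ | _, _ | ⟨_ | _, x⟩⟩ <;> simp at hx <;> exact ⟨_, rfl⟩
  · intro x hx
    rcases x with _ | ⟨_ | _, _ | ⟨_ | _, x⟩⟩ <;> simp at hx <;> exact ⟨_, rfl⟩

/-- Only the rule 0 ↦ 00 matters later; the other two complete it to a bijection between maximal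
prefix codes. -/
noncomputable def shiftElt : ThompsonG := ThompsonG.ofEssIso shiftPEquiv shiftPEquiv_isEssIso

theorem mem_shiftElt (z : List Bool) :
    (false :: false :: z) ∈ shiftElt.toPEquiv (false :: z) :=
  le_maxExt shiftPEquiv_isEssIso _ _ rfl

theorem mem_shiftElt_pow (k : ℕ) (z : List Bool) :
    (List.replicate (k + 1) false ++ z) ∈ (shiftElt ^ k).toPEquiv (false :: z) :=
  ThompsonG.mem_pow (f := fun k => List.replicate (k + 1) false ++ z)
    (fun n => by simpa [List.replicate_succ] using mem_shiftElt (List.replicate n false ++ z)) k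

/-- The map `a b c z ↦ a b (c ⊕ f a b) z`. -/
def xorPEquiv (f : Bool → Bool → Bool) : List Bool ≃. List Bool where
  toFun
    | a :: b :: c :: z => some (a :: b :: (c ^^ f a b) :: z)
    | _ => none
  invFun
    | a :: b :: c :: z => some (a :: b :: (c ^^ f a b) :: z)
    | _ => none
  inv x y := by
    rcases x with _ | ⟨a, _ | ⟨b, _ | ⟨c, x⟩⟩⟩ <;> rcases y with _ | ⟨a', _ | ⟨b', _ | ⟨c', y⟩⟩⟩ <;>
      simp
    constructor
    · rintro ⟨rfl, rfl, rfl, rfl⟩; simp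
    · rintro ⟨rfl, rfl, rfl, rfl⟩; simp

theorem xorPEquiv_isEssIso (f : Bool → Bool → Bool) : IsEssIso (xorPEquiv f) := by
  refine IsEssIso.mk_of_length ?_ ⟨3, ?_⟩ ⟨3, ?_⟩
  · intro x y z h
    rcases x with _ | ⟨a, _ | ⟨b, _ | ⟨c, x⟩⟩⟩ <;>
      simp [xorPEquiv] at h ⊢
    subst h; rfl
  · intro x hx
    rcases x with _ | ⟨a, _ | ⟨b, _ | ⟨c, x⟩⟩⟩ <;> simp at hx; exact ⟨_, rfl⟩
  · intro x hx
    rcases x with _ | ⟨a, _ | ⟨b, _ | ⟨c, x⟩⟩⟩ <;> simp at hx; exact ⟨_, rfl⟩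

noncomputable def xorElt (f : Bool → Bool → Bool) : ThompsonG :=
  ThompsonG.ofEssIso (xorPEquiv f) (xorPEquiv_isEssIso f)

theorem mem_xorElt (f : Bool → Bool → Bool) (a b c : Bool) (z : List Bool) :
    (a :: b :: (c ^^ f a b) :: z) ∈ (xorElt f).toPEquiv (a :: b :: c :: z) :=
  le_maxExt (xorPEquiv_isEssIso f) _ _ rfl

/-! ### Memories and reversible gates -/

/-- The string of the first `N` bits of the memory `M`. -/
def memString (N : ℕ) (M : ℕ → Bool) : List Bool := (List.range N).map M

theorem swapLetters_memString {N i j : ℕ} (hi : i < N) (hj : j < N) (M : ℕ → Bool) :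
    swapLetters i j (memString N M) = memString N (M ∘ Equiv.swap i j) := by
  refine List.ext_getElem (by simp [memString]) fun k h1 h2 => ?_
  have h3 := swap_lt hi hj (show k < N by simpa [memString] using h2)
  rw [getElem_swapLetters, List.getD_eq_getElem _ _ (by simpa [memString] using h3)]
  simp [memString]

/-- The reversible gate that adds `f (M a) (M b)` to the bit number `c` of the memory `M`. -/
structure XorGate where
  a : ℕ
  b : ℕ
  c : ℕ
  f : Bool → Bool → Bool

namespace XorGate

def run (o : XorGate) (M : ℕ → Bool) : ℕ → Bool :=
  Function.update M o.c (M o.c ^^ o.f (M o.a) (M o.b))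

/-- A target different from both sources makes the gate an involution; distinct sources allow the
three cells to be permuted to the front of the memory. -/
structure Distinct (o : XorGate) : Prop where
  ab : o.a ≠ o.b
  ac : o.a ≠ o.c
  bc : o.b ≠ o.c

/-- `o` reads and writes only bits in `S`. -/
structure LivesIn (o : XorGate) (S : Set ℕ) : Prop where
  a : o.a ∈ S
  b : o.b ∈ S
  c : o.c ∈ S

theorem LivesIn.mono {o : XorGate} {S T : Set ℕ} (h : o.LivesIn S) (hST : S ⊆ T) :
    o.LivesIn T :=
  ⟨hST h.a, hST h.b, hST h.c⟩

theorem run_of_ne {o : XorGate} {i : ℕ} (h : i ≠ o.c) (M : ℕ → Bool) : o.run M i = M i :=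
  Function.update_of_ne h _ _

theorem run_run {o : XorGate} (h : o.Distinct) (M : ℕ → Bool) : o.run (o.run M) = M := by
  funext i
  by_cases hi : i = o.c
  · subst hi
    simp [run, Function.update_of_ne h.ac, Function.update_of_ne h.bc]
  · rw [run_of_ne hi, run_of_ne hi]

/-- Run the gates of a list one after the other. -/
def runAll (l : List XorGate) (M : ℕ → Bool) : ℕ → Bool := l.foldl (fun M o => o.run M) M

theorem runAll_cons (o : XorGate) (l : List XorGate) (M : ℕ → Bool) :
    runAll (o :: l) M = runAll l (o.run M) := rfl

theorem runAll_append (l k : List XorGate) (M : ℕ → Bool) :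
    runAll (l ++ k) M = runAll k (runAll l M) :=
  List.foldl_append

theorem runAll_of_forall_ne {l : List XorGate} {i : ℕ} (h : ∀ o ∈ l, i ≠ o.c) (M : ℕ → Bool) :
    runAll l M i = M i := by
  induction l generalizing M with
  | nil => rfl
  | cons o l ih =>
    rw [runAll_cons, ih (fun o ho => h o (List.mem_cons_of_mem _ ho)),
      run_of_ne (h o List.mem_cons_self)]

theorem runAll_reverse {l : List XorGate} (h : ∀ o ∈ l, o.Distinct) (M : ℕ → Bool) :
    runAll l.reverse (runAll l M) = M := by
  induction l generalizing M with
  | nil => rfl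
  | cons o l ih =>
    rw [List.reverse_cons, runAll_append, runAll_cons o l,
      ih (fun o ho => h o (List.mem_cons_of_mem _ ho))]
    exact run_run (h o List.mem_cons_self) M

end XorGate

open XorGate

/-- Add the bits of the string `t` to the bits of the memory `M` from number `s` on. -/
def xorInto (s : ℕ) (t : List Bool) (M : ℕ → Bool) (i : ℕ) : Bool :=
  M i ^^ (decide (s ≤ i) && t.getD (i - s) false)

theorem xorInto_of_outside {s i : ℕ} {t : List Bool} (h : i < s ∨ s + t.length ≤ i)
    (M : ℕ → Bool) : xorInto s t M i = M i := by
  rcases h with h | h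
  · simp [xorInto, Nat.not_le.2 h]
  · simp [xorInto, List.getElem?_eq_none (show t.length ≤ i - s by omega)]

theorem xorInto_xorInto (s : ℕ) (t : List Bool) (M : ℕ → Bool) :
    xorInto s t (xorInto s t M) = M := by
  funext i
  simp [xorInto]

theorem xorInto_comm (s r : ℕ) (t u : List Bool) (M : ℕ → Bool) :
    xorInto s t (xorInto r u M) = xorInto r u (xorInto s t M) := by
  funext i
  simp only [xorInto]
  rw [Bool.xor_assoc, Bool.xor_assoc]
  congr 1
  exact Bool.xor_comm _ _

theorem map_range'_xorInto (s : ℕ) (t : List Bool) (M : ℕ → Bool)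
    (h : ∀ i, s ≤ i → i < s + t.length → M i = false) :
    (List.range' s t.length).map (xorInto s t M) = t := by
  refine List.ext_getElem (by simp) fun k h1 h2 => ?_
  simp [xorInto, h2, h (s + k) (by omega) (by omega)]

theorem memString_xorInto_false (k : ℕ) (t : List Bool) :
    memString (k + t.length) (xorInto k t fun _ => false) = List.replicate k false ++ t := by
  refine List.ext_getElem (by simp [memString]) fun i h1 h2 => ?_
  simp only [memString, List.getElem_map, List.getElem_range]
  by_cases h : i < k
  · rw [xorInto_of_outside (Or.inl h), List.getElem_append_left (by simpa using h)]
    simp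
  · simp only [List.length_append, List.length_replicate] at h2
    rw [List.getElem_append_right (by simpa using h)]
    have : i - k < t.length := by omega
    simp [xorInto, this, Nat.not_lt.1 h]

theorem XorGate.run_xorInto {o : XorGate} {s : ℕ} {t : List Bool}
    (h : o.LivesIn {i | i < s ∨ s + t.length ≤ i}) (M : ℕ → Bool) :
    o.run (xorInto s t M) = xorInto s t (o.run M) := by
  funext i
  by_cases hi : i = o.c
  · subst hi
    rw [xorInto_of_outside h.c]
    simp only [run, Function.update_self]
    rw [xorInto_of_outside h.a, xorInto_of_outside h.b, xorInto_of_outside h.c]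
  · rw [run_of_ne hi]
    simp only [xorInto]
    rw [run_of_ne hi]

/-- This is what lets the backward computation pass over a copied result: gates that neither read
nor write a segment commute with additions to it. -/
theorem XorGate.runAll_xorInto {l : List XorGate} {s : ℕ} {t : List Bool}
    (h : ∀ o ∈ l, o.LivesIn {i | i < s ∨ s + t.length ≤ i}) (M : ℕ → Bool) :
    runAll l (xorInto s t M) = xorInto s t (runAll l M) := by
  induction l generalizing M with
  | nil => rfl
  | cons o l ih =>
    rw [runAll_cons, runAll_cons, run_xorInto (h o List.mem_cons_self),
      ih fun o ho => h o (List.mem_cons_of_mem _ ho)]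

/-- The gates that add the bits with the numbers in the list `p` to the bits from number `s`
on. -/
def copyGates : ℕ → List ℕ → List XorGate
  | _, [] => []
  | s, a :: p => ⟨a, 0, s, fun x _ => x⟩ :: copyGates (s + 1) p

theorem length_copyGates (s : ℕ) (p : List ℕ) : (copyGates s p).length = p.length := by
  induction p generalizing s with
  | nil => rfl
  | cons a p ih => simp [copyGates, ih]

theorem copyGates_spec {s : ℕ} {p : List ℕ} (hs : 0 < s)
    (hp : ∀ x ∈ p, 0 < x ∧ (x < s ∨ s + p.length ≤ x)) :
    ∀ o ∈ copyGates s p, o.Distinct ∧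
      o.LivesIn {i | i = 0 ∨ i ∈ p ∨ s ≤ i ∧ i < s + p.length} := by
  induction p generalizing s with
  | nil => simp [copyGates]
  | cons a p ih =>
    intro o ho
    rcases List.mem_cons.1 ho with rfl | ho
    · have := hp a List.mem_cons_self
      simp only [List.length_cons] at this
      exact ⟨⟨by simp; omega, by simp; omega, by simp; omega⟩,
        ⟨by simp, by simp, by simp⟩⟩
    · have h := ih (s := s + 1) (by omega) (fun x hx => by
        have := hp x (List.mem_cons_of_mem _ hx)
        simp only [List.length_cons] at this
        omega) o ho
      refine ⟨h.1, h.2.mono fun i hi => ?_⟩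
      simp only [Set.mem_ofPred_eq, List.mem_cons, List.length_cons] at hi ⊢
      rcases hi with hi | hi | hi
      · exact Or.inl hi
      · exact Or.inr (Or.inl (Or.inr hi))
      · exact Or.inr (Or.inr (by omega))

/-- The sources lie outside the target segment, so earlier additions do not alter the bits read
later. -/
theorem runAll_copyGates {s : ℕ} {p : List ℕ} (hp : ∀ x ∈ p, x < s ∨ s + p.length ≤ x)
    (M : ℕ → Bool) : runAll (copyGates s p) M = xorInto s (p.map M) M := by
  induction p generalizing s M with
  | nil => funext i; simp [copyGates, runAll, xorInto]
  | cons a p ih =>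
    simp only [List.length_cons] at hp
    rw [copyGates, runAll_cons, ih fun x hx => by
      have := hp x (List.mem_cons_of_mem _ hx)
      omega]
    have h1 : p.map (run ⟨a, 0, s, fun x _ => x⟩ M) = p.map M := by
      refine List.map_congr_left fun x hx => run_of_ne ?_ M
      have := hp x (List.mem_cons_of_mem _ hx)
      simp only
      omega
    rw [h1]
    funext i
    rcases lt_trichotomy i s with h | rfl | h
    · rw [xorInto_of_outside (Or.inl (by omega)), xorInto_of_outside (Or.inl h),
        run_of_ne (by simp only; omega)]
    · rw [xorInto_of_outside (Or.inl (by omega))]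
      simp [xorInto, run]
    · simp only [xorInto]
      rw [run_of_ne (by simp only; omega)]
      obtain ⟨d, rfl⟩ := Nat.exists_eq_add_of_lt h
      have h2 : s + d + 1 - s = d + 1 := by omega
      have h3 : s + d + 1 - (s + 1) = d := by omega
      have h4 : s + 1 ≤ s + d + 1 := by omega
      have h5 : s ≤ s + d + 1 := by omega
      simp [h2, h3, h4, h5]

/-! ### Simulation of circuits by reversible gates -/

/-- The gate that adds `f (M a) (M b)` to the bit number `c`; if `a = b` then the bit number 0
serves as a second, unused argument. -/
def binaryGate (a b c : ℕ) (f : Bool → Bool → Bool) : XorGate :=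
  if a = b then ⟨a, 0, c, fun x _ => f x x⟩ else ⟨a, b, c, f⟩

theorem binaryGate_spec {a b c : ℕ} (f : Bool → Bool → Bool) (ha : 0 < a) (hac : a ≠ c)
    (hbc : b ≠ c) (hc : 0 < c) :
    (binaryGate a b c f).Distinct ∧ (binaryGate a b c f).c = c ∧
      (binaryGate a b c f).LivesIn {i | i = 0 ∨ i = a ∨ i = b ∨ i = c} := by
  unfold binaryGate
  split_ifs with h
  · exact ⟨⟨ha.ne', hac, hc.ne⟩, rfl, ⟨by simp, by simp, by simp⟩⟩
  · exact ⟨⟨h, hac, hbc⟩, rfl, ⟨by simp, by simp, by simp⟩⟩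

theorem run_binaryGate_self (a b c : ℕ) (f : Bool → Bool → Bool) {M : ℕ → Bool}
    (hM : M c = false) : (binaryGate a b c f).run M c = f (M a) (M b) := by
  unfold binaryGate
  split_ifs with h
  · subst h; simp [run, hM]
  · simp [run, hM]

/-- `l` adds a fresh bit number `q` (at most) to the memory, and simulates the operation `G`:
if the wires carry the bits with the numbers in `p` before `G`, then they carry the bits
with the numbers in `p'` afterwards. -/
structure SimulatesGate (G : Gate) (p : List ℕ) (q : ℕ) (l : List XorGate) (p' : List ℕ) :
    Prop where
  length_le : l.length ≤ 1
  gates : ∀ o ∈ l, o.Distinct ∧ o.c = q ∧ o.LivesIn {i | i = 0 ∨ i ∈ p ∨ i = q}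
  wires : ∀ x ∈ p', x ∈ p ∨ x = q
  maps : ∀ (M : ℕ → Bool) (t : List Bool), M q = false → G.Maps (p.map M) t →
    t = p'.map (runAll l M)

theorem SimulatesGate.of_forall_not_maps {G : Gate} {p : List ℕ} {q : ℕ}
    (h : ∀ M t, ¬ G.Maps (p.map M) t) : SimulatesGate G p q [] p :=
  ⟨by simp, by simp, fun _ => Or.inl, fun M t _ hG => (h M t hG).elim⟩

theorem SimulatesGate.of_pointers {G : Gate} {p p' : List ℕ} {q : ℕ} (hp : ∀ x ∈ p', x ∈ p)
    (h : ∀ M t, G.Maps (p.map M) t → t = p'.map M) : SimulatesGate G p q [] p' :=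
  ⟨by simp, by simp, fun x hx => Or.inl (hp x hx), fun M t _ hG => h M t hG⟩

theorem SimulatesGate.of_binary {G : Gate} {p u v : List ℕ} {a b q : ℕ}
    (f : Bool → Bool → Bool) (hp : ∀ x ∈ p, 0 < x ∧ x ≠ q) (hq : 0 < q)
    (hu : ∀ x ∈ u, x ∈ p) (hv : ∀ x ∈ v, x ∈ p) (ha : a ∈ p) (hb : b ∈ p)
    (h : ∀ M t, G.Maps (p.map M) t → t = u.map M ++ f (M a) (M b) :: v.map M) :
    SimulatesGate G p q [binaryGate a b q f] (u ++ q :: v) := by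
  have hs := binaryGate_spec f (hp a ha).1 (hp a ha).2 (hp b hb).2 hq
  refine ⟨by simp, ?_, ?_, ?_⟩
  · intro o ho
    rw [List.mem_singleton.1 ho]
    refine ⟨hs.1, hs.2.1, hs.2.2.mono ?_⟩
    rintro i (h | h | h | h) <;> simp [h, ha, hb]
  · intro x hx
    rcases List.mem_append.1 hx with hx | hx
    · exact Or.inl (hu x hx)
    · rcases List.mem_cons.1 hx with hx | hx
      exacts [Or.inr hx, Or.inl (hv x hx)]
  · intro M t hM hG
    have hne : ∀ x ∈ p, runAll [binaryGate a b q f] M x = M x := fun x hx =>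
      run_of_ne (by rw [hs.2.1]; exact (hp x hx).2) M
    have hself : runAll [binaryGate a b q f] M q = f (M a) (M b) :=
      run_binaryGate_self a b q f hM
    rw [h M t hG, List.map_append, List.map_cons, hself,
      List.map_congr_left fun x hx => hne x (hu x hx),
      List.map_congr_left fun x hx => hne x (hv x hx)]

theorem exists_eq_append_cons {α : Type*} {p : List α} {i : ℕ} (h : i < p.length) :
    ∃ u a v, p = u ++ a :: v ∧ u.length = i :=
  ⟨p.take i, p[i], p.drop (i + 1), by simp, by simp; omega⟩

/-- Whether and where a gate acts depends only on its index and the number of wires. One possible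
transition therefore shows how to split `p`, and the same splitting serves every memory. If no
transition exists, the claim is vacuous. -/
theorem exists_simulatesGate (G : Gate) (p : List ℕ) (q : ℕ) (hp : ∀ x ∈ p, 0 < x ∧ x ≠ q)
    (hq : 0 < q) : ∃ l p', SimulatesGate G p q l p' := by
  by_cases hG : ∃ M t, G.Maps (p.map M) t
  swap
  · exact ⟨[], p, SimulatesGate.of_forall_not_maps fun M t h => hG ⟨M, t, h⟩⟩
  obtain ⟨M₀, t₀, hG⟩ := hG
  generalize hs : p.map M₀ = s at hG
  have hlen : p.length = s.length := by rw [← hs, List.length_map]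
  have app : ∀ {u : List ℕ} {u' : List Bool} {w : List ℕ} {w' : List Bool} {M : ℕ → Bool},
      (u ++ w).map M = u' ++ w' → u'.length = u.length → u.map M = u' ∧ w.map M = w' := by
    intro u u' w w' M h hl
    rw [List.map_append] at h
    exact List.append_inj h (by simp [hl])
  cases hG with
  | and u₀ v₀ a₀ b₀ =>
    obtain ⟨u, a, w, rfl, hu⟩ := exists_eq_append_cons (p := p) (i := u₀.length)
      (by rw [hlen]; simp)
    obtain ⟨b, v, rfl⟩ : ∃ b v, w = b :: v := by
      cases w with
      | nil => simp [hu] at hlen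
      | cons b v => exact ⟨b, v, rfl⟩
    refine ⟨_, _, SimulatesGate.of_binary (u := u) (v := v) (a := a) (b := b) and hp hq
      (by simp_all) (by simp_all) (by simp) (by simp) ?_⟩
    intro M t h
    -- With the indices turned into variables, case analysis applies; `hi` then forces the two
    -- prefixes to have equal length.
    generalize hs' : (u ++ a :: b :: v).map M = s' at h
    generalize hi : u₀.length + 1 = i at h
    cases h with
    | and u' v' a' b' =>
      obtain ⟨h1, h2⟩ := app hs' (by omega)
      simp only [List.map_cons, List.cons.injEq] at h2
      obtain ⟨rfl, rfl, rfl⟩ := h2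
      rw [h1]
  | or u₀ v₀ a₀ b₀ =>
    obtain ⟨u, a, w, rfl, hu⟩ := exists_eq_append_cons (p := p) (i := u₀.length)
      (by rw [hlen]; simp)
    obtain ⟨b, v, rfl⟩ : ∃ b v, w = b :: v := by
      cases w with
      | nil => simp [hu] at hlen
      | cons b v => exact ⟨b, v, rfl⟩
    refine ⟨_, _, SimulatesGate.of_binary (u := u) (v := v) (a := a) (b := b) or hp hq
      (by simp_all) (by simp_all) (by simp) (by simp) ?_⟩
    intro M t h
    generalize hs' : (u ++ a :: b :: v).map M = s' at h
    generalize hi : u₀.length + 1 = i at h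
    cases h with
    | or u' v' a' b' =>
      obtain ⟨h1, h2⟩ := app hs' (by omega)
      simp only [List.map_cons, List.cons.injEq] at h2
      obtain ⟨rfl, rfl, rfl⟩ := h2
      rw [h1]
  | not u₀ v₀ a₀ =>
    obtain ⟨u, a, v, rfl, hu⟩ := exists_eq_append_cons (p := p) (i := u₀.length)
      (by rw [hlen]; simp)
    refine ⟨_, _, SimulatesGate.of_binary (u := u) (v := v) (a := a) (b := a)
      (fun x _ => !x) hp hq (by simp_all) (by simp_all) (by simp) (by simp) ?_⟩
    intro M t h
    generalize hs' : (u ++ a :: v).map M = s' at h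
    generalize hi : u₀.length + 1 = i at h
    cases h with
    | not u' v' a' =>
      obtain ⟨h1, h2⟩ := app hs' (by omega)
      simp only [List.map_cons, List.cons.injEq] at h2
      obtain ⟨rfl, rfl⟩ := h2
      rw [h1]
  | fork u₀ v₀ a₀ =>
    obtain ⟨u, a, v, rfl, hu⟩ := exists_eq_append_cons (p := p) (i := u₀.length)
      (by rw [hlen]; simp)
    refine ⟨_, _, SimulatesGate.of_pointers (p' := u ++ a :: a :: v) (by simp) ?_⟩
    intro M t h
    generalize hs' : (u ++ a :: v).map M = s' at h
    generalize hi : u₀.length + 1 = i at h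
    cases h with
    | fork u' v' a' =>
      obtain ⟨h1, h2⟩ := app hs' (by omega)
      simp only [List.map_cons, List.cons.injEq] at h2
      obtain ⟨rfl, rfl⟩ := h2
      simp [h1]
  | swap u₀ v₀ w₀ a₀ b₀ =>
    obtain ⟨u, a, x, rfl, hu⟩ := exists_eq_append_cons (p := p) (i := u₀.length)
      (by rw [hlen]; simp)
    obtain ⟨v, b, w, rfl, hv⟩ := exists_eq_append_cons (p := x) (i := v₀.length)
      (by simp at hlen; omega)
    refine ⟨_, _, SimulatesGate.of_pointers (p' := u ++ b :: (v ++ a :: w))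
      (by simp; grind) ?_⟩
    intro M t h
    generalize hs' : (u ++ a :: (v ++ b :: w)).map M = s' at h
    generalize hi : u₀.length + 1 = i at h
    generalize hj : i + v₀.length + 1 = j at h
    cases h with
    | swap u' v' w' a' b' =>
      obtain ⟨h1, h2⟩ := app hs' (by omega)
      rw [List.map_cons, List.cons.injEq] at h2
      obtain ⟨rfl, h2⟩ := h2
      obtain ⟨h3, h4⟩ := app h2 (by omega)
      rw [List.map_cons, List.cons.injEq] at h4
      obtain ⟨rfl, rfl⟩ := h4
      simp [h1, h3]

/-- One cell is reserved per circuit gate: the first gate may write only to `q`, so the rest finds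
its cells from `q + 1` on still zero. -/
theorem exists_gates_simulating (L : List Gate) (p : List ℕ) (q : ℕ)
    (hp : ∀ x ∈ p, 0 < x ∧ (x < q ∨ q + L.length ≤ x)) (hq : 0 < q) :
    ∃ (l : List XorGate) (p' : List ℕ), l.length ≤ L.length ∧
      (∀ o ∈ l, o.Distinct ∧ o.LivesIn {i | i = 0 ∨ i ∈ p ∨ q ≤ i ∧ i < q + L.length}) ∧
      (∀ x ∈ p', x ∈ p ∨ q ≤ x ∧ x < q + L.length) ∧
      ∀ (M : ℕ → Bool) (t : List Bool), (∀ i, q ≤ i → i < q + L.length → M i = false) →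
        GatesMap L (p.map M) t → t = p'.map (runAll l M) := by
  induction L generalizing p q with
  | nil =>
    refine ⟨[], p, by simp, by simp, fun x hx => Or.inl hx, fun M t _ h => ?_⟩
    generalize hs : p.map M = s at h
    cases h
    exact hs.symm
  | cons G L ih =>
    simp only [List.length_cons] at hp ⊢
    obtain ⟨l, p₁, h⟩ := exists_simulatesGate G p q
      (fun x hx => by have := hp x hx; omega) hq
    obtain ⟨k, p₂, h1, h2, h3, h4⟩ := ih p₁ (q + 1) (fun x hx => by
      rcases h.wires x hx with hx | hx
      · have := hp x hx; omega
      · omega) (by omega)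
    refine ⟨l ++ k, p₂, ?_, ?_, ?_, ?_⟩
    · have := h.length_le
      simp only [List.length_append]
      omega
    · intro o ho
      rcases List.mem_append.1 ho with ho | ho
      · refine ⟨(h.gates o ho).1, (h.gates o ho).2.2.mono ?_⟩
        rintro i (hi | hi | hi)
        · exact Or.inl hi
        · exact Or.inr (Or.inl hi)
        · exact Or.inr (Or.inr (by omega))
      · refine ⟨(h2 o ho).1, (h2 o ho).2.mono ?_⟩
        rintro i (hi | hi | hi)
        · exact Or.inl hi
        · rcases h.wires i hi with hi | hi
          · exact Or.inr (Or.inl hi)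
          · exact Or.inr (Or.inr (by omega))
        · exact Or.inr (Or.inr (by omega))
    · intro x hx
      rcases h3 x hx with hx | hx
      · rcases h.wires x hx with hx | hx
        · exact Or.inl hx
        · exact Or.inr (by omega)
      · exact Or.inr (by omega)
    · intro M t hM hL
      generalize hs : p.map M = s at hL
      cases hL with
      | cons hG hL =>
        subst hs
        rw [runAll_append]
        refine h4 (runAll l M) t (fun i h5 h6 => ?_) ?_
        · rw [runAll_of_forall_ne fun o ho => by rw [(h.gates o ho).2.1]; omega]
          exact hM i (by omega) (by omega)
        · rwa [← h.maps M _ (hM q (by omega) (by omega)) hG]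

/-- Compute, copy the result, and uncompute. -/
theorem exists_gates_xorInto (L : List Gate) (p : List ℕ) (q y n N : ℕ)
    (hp : ∀ x ∈ p, 0 < x ∧ x < N ∧ (x < q ∨ q + L.length ≤ x) ∧ (x < y ∨ y + n ≤ x))
    (hq : 0 < q) (hy : 0 < y) (hqN : q + L.length ≤ N) (hyN : y + n ≤ N)
    (hqy : q + L.length ≤ y ∨ y + n ≤ q) :
    ∃ l : List XorGate, l.length ≤ 2 * L.length + n ∧
      (∀ o ∈ l, o.Distinct ∧ o.LivesIn {i | i < N}) ∧
      ∀ (M : ℕ → Bool) (t : List Bool), t.length = n →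
        (∀ i, q ≤ i → i < q + L.length → M i = false) →
        GatesMap L (p.map M) t → runAll l M = xorInto y t M := by
  obtain ⟨l, p', h1, h2, h3, h4⟩ := exists_gates_simulating L p q
    (fun x hx => ⟨(hp x hx).1, (hp x hx).2.2.1⟩) hq
  have hp' : ∀ x ∈ p', 0 < x ∧ x < N ∧ (x < y ∨ y + n ≤ x) := by
    intro x hx
    rcases h3 x hx with hx | hx
    · have := hp x hx; omega
    · omega
  have hlN : {i | i = 0 ∨ i ∈ p ∨ q ≤ i ∧ i < q + L.length} ⊆ {i | i < N} := by
    rintro i (hi | hi | hi)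
    · simp only [Set.mem_ofPred_eq]; omega
    · exact (hp i hi).2.1
    · simp only [Set.mem_ofPred_eq]; omega
  have hly : {i | i = 0 ∨ i ∈ p ∨ q ≤ i ∧ i < q + L.length} ⊆ {i | i < y ∨ y + n ≤ i} := by
    rintro i (hi | hi | hi)
    · exact Or.inl (by omega)
    · exact (hp i hi).2.2.2
    · simp only [Set.mem_ofPred_eq]; omega
  -- Nothing fixes the length of `p'` if the circuit has no run. Truncation secures the bounds in
  -- all cases and changes nothing in an actual run (`hpl`).
  have hlen : (p'.take n).length ≤ n := by simp
  refine ⟨l ++ (copyGates y (p'.take n) ++ l.reverse), ?_, ?_, ?_⟩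
  · simp only [List.length_append, List.length_reverse, length_copyGates]
    omega
  · intro o ho
    simp only [List.mem_append, List.mem_reverse] at ho
    rcases ho with ho | ho | ho
    · exact ⟨(h2 o ho).1, (h2 o ho).2.mono hlN⟩
    · have := copyGates_spec (p := p'.take n) hy (fun x hx => by
        have := hp' x (List.mem_of_mem_take hx)
        omega) o ho
      refine ⟨this.1, this.2.mono ?_⟩
      rintro i (hi | hi | hi)
      · simp only [Set.mem_ofPred_eq]; omega
      · exact (hp' i (List.mem_of_mem_take hi)).2.1
      · simp only [Set.mem_ofPred_eq]; omega
    · exact ⟨(h2 o ho).1, (h2 o ho).2.mono hlN⟩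
  · rintro M t rfl hM hL
    have ht := h4 M t hM hL
    have hpl : p'.take t.length = p' := by
      refine List.take_of_length_le ?_
      rw [ht, List.length_map]
    rw [hpl, runAll_append, runAll_append, runAll_copyGates (fun x hx => by
      have := hp' x hx
      rw [ht, List.length_map] at this
      exact this.2.2), ← ht, runAll_xorInto (fun o ho => (h2 o (by simpa using ho)).2.mono hly),
      runAll_reverse fun o ho => (h2 o ho).1]

/-- A permutation and its inverse, both given by circuits, yield reversible gates that
replace the bits of a string by those of its image. -/
theorem exists_gates_perm {m : ℕ} (g : Equiv.Perm (List.Vector Bool m)) (C D : Circuit m m)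
    (hC : C.Computes g) (hD : D.Computes g.symm) (k : ℕ)
    (hCk : m + C.gates.length ≤ k) (hDk : m + D.gates.length ≤ k) :
    ∃ l : List XorGate, l.length ≤ 2 * (C.size + D.size) ∧
      (∀ o ∈ l, o.Distinct ∧ o.LivesIn {i | i < k + 1 + m}) ∧
      ∀ x : List.Vector Bool m, runAll l (xorInto (k + 1) x.toList fun _ => false) =
        xorInto (k + 1) (g x).toList fun _ => false := by
  have hr : ∀ s (x : List.Vector Bool m) (M : ℕ → Bool),
      (∀ i, s ≤ i → i < s + m → M i = false) →
      (List.range' s m).map (xorInto s x.toList M) = x.toList := by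
    intro s x M h
    have := map_range'_xorInto s x.toList M (by simpa using h)
    rwa [List.Vector.toList_length] at this
  -- Layout: cell 0 is the dummy argument, cells 1 to `m` are the auxiliary register, cells `m + 1`
  -- to `k` are scratch space, and the input starts at `k + 1`.
  obtain ⟨l₁, h1, h1', h1''⟩ := exists_gates_xorInto C.gates (List.range' (k + 1) m) (1 + m) 1 m
    (k + 1 + m) (fun x hx => by rw [List.mem_range'_1] at hx; omega) (by omega) (by omega)
    (by omega) (by omega) (by omega)
  obtain ⟨l₂, h2, h2', h2''⟩ := exists_gates_xorInto D.gates (List.range' 1 m) (1 + m) (k + 1) m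
    (k + 1 + m) (fun x hx => by rw [List.mem_range'_1] at hx; omega) (by omega) (by omega)
    (by omega) (by omega) (by omega)
  -- The empty circuit gives plain copying: `l₃` copies g(x) back, and `l₄` clears the auxiliary
  -- register.
  obtain ⟨l₃, h3, h3', h3''⟩ := exists_gates_xorInto [] (List.range' 1 m) (1 + m) (k + 1) m
    (k + 1 + m) (fun x hx => by rw [List.mem_range'_1] at hx; rw [List.length_nil]; omega)
    (by omega) (by omega) (by rw [List.length_nil]; omega) (by omega) (by rw [List.length_nil]; omega)
  obtain ⟨l₄, h4, h4', h4''⟩ := exists_gates_xorInto [] (List.range' (k + 1) m) (1 + m) 1 m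
    (k + 1 + m) (fun x hx => by rw [List.mem_range'_1] at hx; rw [List.length_nil]; omega)
    (by omega) (by omega) (by rw [List.length_nil]; omega) (by omega) (by rw [List.length_nil]; omega)
  refine ⟨l₁ ++ (l₂ ++ (l₃ ++ l₄)), ?_, ?_, fun x => ?_⟩
  · simp only [List.length_append, Circuit.size, List.length_nil] at *
    omega
  · intro o ho
    simp only [List.mem_append] at ho
    rcases ho with ho | ho | ho | ho
    exacts [h1' o ho, h2' o ho, h3' o ho, h4' o ho]
  · have zero : ∀ s (t : List.Vector Bool m) (M : ℕ → Bool) i, (i < s ∨ s + m ≤ i) →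
        M i = false → xorInto s t.toList M i = false := by
      intro s t M i hi h
      rw [xorInto_of_outside (by simpa using hi), h]
    rw [runAll_append, runAll_append, runAll_append]
    rw [h1'' _ (g x).toList (by simp)
      (fun i _ _ => zero _ _ _ _ (by omega) rfl)
      (by rw [hr _ _ _ fun _ _ _ => rfl]; exact hC x)]
    rw [h2'' _ x.toList (by simp)
      (fun i _ _ => zero _ _ _ _ (by omega) (zero _ _ _ _ (by omega) rfl))
      (by
        rw [hr _ _ _ fun i _ _ => zero _ _ _ _ (by omega) rfl]
        simpa using hD (g x))]
    -- The string `x` has been added twice to the input register, which is now zero.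
    rw [xorInto_comm, xorInto_xorInto]
    rw [h3'' _ (g x).toList (by simp)
      (fun i _ hi => by rw [List.length_nil] at hi; omega)
      (by rw [hr _ _ _ fun _ _ _ => rfl]; exact GatesMap.nil _)]
    rw [h4'' _ (g x).toList (by simp)
      (fun i _ hi => by rw [List.length_nil] at hi; omega)
      (by
        rw [hr _ _ _ fun i _ _ => zero _ _ _ _ (by omega) rfl]
        exact GatesMap.nil _)]
    rw [xorInto_comm, xorInto_xorInto]

/-! ### Realization of memory operations by words -/

/-- The operation `P` on memories of `N` bits is the action of a word of length at most `ℓ`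
whose position transpositions concern only the first `N` letters. -/
def Realizes (Γ : Set ThompsonG) (N ℓ : ℕ) (P : (ℕ → Bool) → ℕ → Bool) : Prop :=
  ∃ W : GroupWord Γ, W.length ≤ ℓ ∧
    (∀ (i : ℕ) (hi : 1 ≤ i) (e : Bool), (Letter.trans i hi, e) ∈ W → i + 1 ≤ N) ∧
    ∀ M, memString N (P M) ∈ W.value.toPEquiv (memString N M)

namespace Realizes

variable {Γ : Set ThompsonG} {N ℓ k : ℕ} {P Q : (ℕ → Bool) → ℕ → Bool}

theorem mono (h : Realizes Γ N ℓ P) (hk : ℓ ≤ k) : Realizes Γ N k P := by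
  obtain ⟨W, h1, h2⟩ := h
  exact ⟨W, h1.trans hk, h2⟩

theorem id : Realizes Γ N 0 fun M => M :=
  ⟨[], by simp, by simp, fun M => by rw [GroupWord.value_nil]; exact ThompsonG.mem_one _⟩

theorem comp (hP : Realizes Γ N ℓ P) (hQ : Realizes Γ N k Q) :
    Realizes Γ N (ℓ + k) fun M => P (Q M) := by
  obtain ⟨U, hU, hU', hU''⟩ := hP
  obtain ⟨V, hV, hV', hV''⟩ := hQ
  refine ⟨U ++ V, by simp only [List.length_append]; omega, ?_, fun M => ?_⟩
  · intro i hi e h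
    rcases List.mem_append.1 h with h | h
    exacts [hU' _ _ _ h, hV' _ _ _ h]
  · rw [GroupWord.value_append]
    exact ThompsonG.mul_apply (hV'' M) (hU'' (Q M))

theorem swap_succ {i : ℕ} (hi : i + 1 < N) :
    Realizes Γ N 1 fun M => M ∘ Equiv.swap i (i + 1) := by
  refine ⟨[(Letter.trans (i + 1) (by omega), true)], by simp, ?_, fun M => ?_⟩
  · intro j hj e h
    simp only [List.mem_singleton, Prod.mk.injEq, Letter.trans.injEq] at h
    omega
  · rw [GroupWord.value_singleton]
    refine le_maxExt (tauPEquiv_isEssIso _ _ _ _) _ _ (mem_tauPEquiv.2 ⟨?_, ?_⟩)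
    · simp [memString]; omega
    · exact (swapLetters_memString (by omega) (by omega) M).symm

/-- Conjugating by an adjacent transposition moves one end of the exchange by one place and costs
two letters. -/
theorem swap_add (i d : ℕ) (hi : i + d + 1 < N) :
    Realizes Γ N (2 * d + 1) fun M => M ∘ Equiv.swap i (i + d + 1) := by
  induction d with
  | zero => exact swap_succ hi
  | succ d ih =>
    have h1 : Realizes Γ N 1 _ := swap_succ (i := i + d + 1) hi
    convert ((h1.comp (ih (by omega))).comp h1).mono (k := 2 * (d + 1) + 1) (by omega) using 1
    funext M
    symm
    rw [Function.comp_assoc, Function.comp_assoc, ← Equiv.coe_trans, ← Equiv.coe_trans]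
    congr 2
    change Equiv.swap _ _ * Equiv.swap _ _ * Equiv.swap _ _ = _
    rw [Equiv.swap_mul_swap_mul_swap (by omega) (by omega), Equiv.swap_comm]
    rfl

theorem swap {i j : ℕ} (hi : i < N) (hj : j < N) :
    Realizes Γ N (2 * N) fun M => M ∘ Equiv.swap i j := by
  rcases lt_trichotomy i j with h | rfl | h
  · obtain ⟨d, rfl⟩ := Nat.exists_eq_add_of_lt h
    exact (swap_add i d hj).mono (by omega)
  · simpa using id.mono (Nat.zero_le _)
  · obtain ⟨d, rfl⟩ := Nat.exists_eq_add_of_lt h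
    rw [Equiv.swap_comm]
    exact (swap_add j d hi).mono (by omega)

/-- Three transpositions of cost at most `2 * N` place the cells one after another. Since the cells
are distinct, the later transpositions fix the places already filled. -/
theorem exists_perm {a b c : ℕ} (hab : a ≠ b) (hac : a ≠ c) (hbc : b ≠ c) (ha : a < N)
    (hb : b < N) (hc : c < N) (hN : 3 ≤ N) :
    ∃ π : Equiv.Perm ℕ, π 0 = a ∧ π 1 = b ∧ π 2 = c ∧
      (Realizes Γ N (6 * N) fun M => M ∘ π) ∧ Realizes Γ N (6 * N) fun M => M ∘ π.symm := by
  set σ := Equiv.swap 0 a with hσ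
  set b' := σ b with hb'
  set ρ := Equiv.swap 1 b' with hρ
  set c' := ρ (σ c) with hc'
  set τ := Equiv.swap 2 c' with hτ
  have hb'N : b' < N := swap_lt (by omega) ha hb
  have hc'N : c' < N := swap_lt (by omega) hb'N (swap_lt (by omega) ha hc)
  have hb'0 : b' ≠ 0 := fun h => hab (σ.injective (by rw [← hb', h]; simp [hσ]))
  have hρ0 : ρ 0 = 0 := Equiv.swap_apply_of_ne_of_ne (by omega) hb'0.symm
  have hc'0 : c' ≠ 0 := fun h => hac (σ.injective (ρ.injective (by
    rw [← hc', h]; simp [hσ, hρ0])))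
  have hc'1 : c' ≠ 1 := fun h => hbc (σ.injective (ρ.injective (by
    rw [← hc', h, ← hb']; simp [hρ])))
  have hτ0 : τ 0 = 0 := Equiv.swap_apply_of_ne_of_ne (by omega) hc'0.symm
  have hτ1 : τ 1 = 1 := Equiv.swap_apply_of_ne_of_ne (by omega) hc'1.symm
  have h1 : Realizes Γ N _ fun M => M ∘ σ := swap (by omega) ha
  have h2 : Realizes Γ N _ fun M => M ∘ ρ := swap (by omega) hb'N
  have h3 : Realizes Γ N _ fun M => M ∘ τ := swap (by omega) hc'N
  refine ⟨(τ.trans ρ).trans σ, ?_, ?_, ?_, ?_, ?_⟩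
  · simp [hτ0, hρ0, hσ]
  · simp [hτ1, hρ, hb', hσ]
  · simp [hτ, hc', hρ, hσ]
  · exact ((h3.comp h2).comp h1).mono (by omega)
  · exact ((h1.comp h2).comp h3).mono (by omega)

theorem xorGate_front {K : ℕ} (f : Bool → Bool → Bool) (hN : 3 ≤ N)
    (h : ∃ W : GroupWord Γ, (∀ i hi e, (Letter.trans i hi, e) ∉ W) ∧ W.value = xorElt f ∧
      W.length ≤ K) : Realizes Γ N K (XorGate.run ⟨0, 1, 2, f⟩) := by
  obtain ⟨W, h1, h2, h3⟩ := h
  refine ⟨W, h3, fun i hi e h => (h1 i hi e h).elim, fun M => ?_⟩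
  obtain ⟨n, rfl⟩ := Nat.exists_eq_add_of_le' hN
  rw [h2]
  have h4 : ∀ M : ℕ → Bool, memString (n + 3) M =
      M 0 :: M 1 :: M 2 :: (List.range n).map fun i => M (i + 3) := by
    intro M
    simp [memString, List.range_succ_eq_map]
  rw [h4, h4]
  have h5 : ∀ i, i ≠ 2 → XorGate.run ⟨0, 1, 2, f⟩ M i = M i := fun i hi => run_of_ne hi M
  rw [h5 0 (by omega), h5 1 (by omega)]
  simp only [h5 _ (show _ + 3 ≠ 2 by omega)]
  simpa [XorGate.run] using mem_xorElt f (M 0) (M 1) (M 2) _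

/-- The gate is conjugated to the front of the memory; the permutation and its inverse cost `6 * N`
each. -/
theorem xorGate {K : ℕ} (hN : 3 ≤ N)
    (h : ∀ f, ∃ W : GroupWord Γ, (∀ i hi e, (Letter.trans i hi, e) ∉ W) ∧
      W.value = xorElt f ∧ W.length ≤ K)
    {o : XorGate} (ho : o.Distinct) (hoN : o.LivesIn {i | i < N}) :
    Realizes Γ N (12 * N + K) o.run := by
  obtain ⟨π, h0, h1, h2, h3, h4⟩ :=
    exists_perm (Γ := Γ) ho.ab ho.ac ho.bc hoN.a hoN.b hoN.c hN
  convert ((h4.comp (xorGate_front o.f hN (h o.f))).comp h3).mono (k := 12 * N + K) (by omega)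
    using 1
  funext M i
  simp only [XorGate.run, Function.comp_apply, Function.update_apply, h0, h1, h2,
    Equiv.symm_apply_eq, Equiv.apply_symm_apply]

theorem runAll {K : ℕ} (hN : 3 ≤ N)
    (h : ∀ f, ∃ W : GroupWord Γ, (∀ i hi e, (Letter.trans i hi, e) ∉ W) ∧
      W.value = xorElt f ∧ W.length ≤ K)
    {l : List XorGate} (hl : ∀ o ∈ l, o.Distinct ∧ o.LivesIn {i | i < N}) :
    Realizes Γ N (l.length * (12 * N + K)) (XorGate.runAll l) := by
  induction l with
  | nil => exact id.mono (Nat.zero_le _)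
  | cons o l ih =>
    have ho := hl o List.mem_cons_self
    refine ((ih fun o ho => hl o (List.mem_cons_of_mem _ ho)).comp
      (xorGate hN h ho.1 ho.2)).mono ?_
    rw [List.length_cons, Nat.add_mul, Nat.one_mul]

end Realizes

/-! ### Assembly of the word and its bounds -/

theorem exists_word_of_circuits {Γ : Set ThompsonG} {K m : ℕ} {S : GroupWord Γ}
    (hK : ∀ f, ∃ W : GroupWord Γ, (∀ i hi e, (Letter.trans i hi, e) ∉ W) ∧
      W.value = xorElt f ∧ W.length ≤ K)
    (hS : ∀ i hi e, (Letter.trans i hi, e) ∉ S) (hS' : S.value = shiftElt)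
    (g : Equiv.Perm (List.Vector Bool m)) (C D : Circuit m m)
    (hC : C.Computes g) (hD : D.Computes g.symm) (hm : 0 < m) (k : ℕ)
    (hCk : m + C.gates.length ≤ k) (hDk : m + D.gates.length ≤ k) :
    ∃ W : GroupWord Γ,
      W.length ≤ 2 * (C.size + D.size) * (12 * (k + 1 + m) + K) + 2 * (k * S.length) ∧
      (∀ i hi e, (Letter.trans i hi, e) ∈ W → i + 1 ≤ k + 1 + m) ∧
      ∀ x : List.Vector Bool m,
        (false :: (g x).toList) ∈ W.value.toPEquiv (false :: x.toList) := by
  obtain ⟨l, hl, hl', hl''⟩ := exists_gates_perm g C D hC hD k hCk hDk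
  -- Since `1 ≤ m ≤ k`, the memory has the three cells that a gate needs.
  obtain ⟨V, hV, hV', hV''⟩ := Realizes.runAll (N := k + 1 + m) (by omega) hK hl'
  have hT : ∀ i hi e, (Letter.trans i hi, e) ∉ (List.replicate k S).flatten := by
    intro i hi e h
    obtain ⟨U, hU, h⟩ := List.mem_flatten.1 h
    rw [(List.mem_replicate.1 hU).2] at h
    exact hS i hi e h
  refine ⟨FreeGroup.invRev (List.replicate k S).flatten ++ (V ++ (List.replicate k S).flatten),
    ?_, ?_, fun x => ?_⟩
  · have h1 : V.length ≤ 2 * (C.size + D.size) * (12 * (k + 1 + m) + K) :=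
      hV.trans (Nat.mul_le_mul_right _ hl)
    simp only [List.length_append, FreeGroup.invRev_length, List.length_flatten,
      List.map_replicate, List.sum_replicate, smul_eq_mul]
    omega
  · intro i hi e h
    rcases List.mem_append.1 h with h | h
    · exact (hT _ _ _ (GroupWord.mem_invRev h)).elim
    · rcases List.mem_append.1 h with h | h
      exacts [hV' _ _ _ h, (hT _ _ _ h).elim]
  · have hmem : ∀ t : List.Vector Bool m,
        memString (k + 1 + m) (xorInto (k + 1) t.toList fun _ => false) =
          List.replicate (k + 1) false ++ t.toList := fun t => by
      simpa using memString_xorInto_false (k + 1) t.toList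
    have h := hV'' (xorInto (k + 1) x.toList fun _ => false)
    rw [hl'', hmem, hmem] at h
    rw [GroupWord.value_append, GroupWord.value_append, GroupWord.value_invRev,
      GroupWord.value_flatten_replicate, hS']
    exact ThompsonG.mul_apply (ThompsonG.mul_apply (mem_shiftElt_pow k _) h)
      (ThompsonG.mem_inv.2 (mem_shiftElt_pow k _))

theorem exists_word_bound {Γ : Set ThompsonG} (hgen : Subgroup.closure Γ = ⊤) :
    ∃ c : ℕ, ∀ (m : ℕ) (g : Equiv.Perm (List.Vector Bool m)) (C D : Circuit m m),
      C.Computes g → D.Computes g.symm →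
      ∃ W : GroupWord Γ, W.length ≤ c * (C.size ^ 4 + D.size ^ 4) ∧
        (∀ i hi e, (Letter.trans i hi, e) ∈ W → i + 1 ≤ max (C.size ^ 2) (D.size ^ 2) + 2) ∧
        ∀ x : List.Vector Bool m,
          (false :: (g x).toList) ∈ W.value.toPEquiv (false :: x.toList) := by
  obtain ⟨S, hS, hS'⟩ := GroupWord.exists_value_eq hgen shiftElt
  choose X hX hX' using fun f => GroupWord.exists_value_eq hgen (xorElt f)
  -- There are only sixteen functions `f`, so their words have a common length bound, independent of
  -- g.
  obtain ⟨K, hK⟩ : ∃ K, ∀ f, (X f).length ≤ K :=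
    ⟨∑ f, (X f).length, fun f =>
      Finset.single_le_sum (f := fun f => (X f).length) (fun _ _ => Nat.zero_le _)
        (Finset.mem_univ f)⟩
  refine ⟨96 + 4 * K + 4 * S.length, fun m g C D hC hD => ?_⟩
  -- For `m = 0` the only permutation is the identity, and the empty word serves.
  rcases Nat.eq_zero_or_pos m with rfl | hm
  · refine ⟨[], by simp, by simp, fun x => ?_⟩
    rw [GroupWord.value_nil, Subsingleton.elim (g x) x]
    exact ThompsonG.mem_one _
  obtain ⟨W, h1, h2, h3⟩ := exists_word_of_circuits
    (fun f => ⟨X f, hX f, hX' f, hK f⟩) hS hS' g C D hC hD hm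
    -- This is the least admissible `k`. The memory then has `B + 1` cells, because a circuit's size
    -- counts its gates and `2 * m` ports.
    (m + max C.gates.length D.gates.length) (by omega) (by omega)
  set B := max C.size D.size with hB
  have hB2 : 2 ≤ B := by simp only [hB, Circuit.size]; omega
  have hk : m + max C.gates.length D.gates.length + 1 + m ≤ B + 1 := by
    simp only [hB, Circuit.size]; omega
  refine ⟨W, h1.trans ?_, fun i hi e h => (h2 i hi e h).trans (hk.trans ?_), h3⟩
  · have h4 : 2 * (C.size + D.size) ≤ 4 * B := by omega
    have h5 : m + max C.gates.length D.gates.length ≤ 2 * B := by omega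
    have h6 : B ^ 4 ≤ C.size ^ 4 + D.size ^ 4 := by
      rcases max_choice C.size D.size with h | h <;> rw [hB, h] <;> omega
    have h7 : B * B ≤ B ^ 4 := by
      rw [← sq]; exact Nat.pow_le_pow_right (by omega) (by omega)
    -- Every term is rounded up to a multiple of `B * B`, using `B + 1 ≤ 2 * B`; this produces the
    -- constant.
    calc _ ≤ 4 * B * (12 * (2 * B) + K * B) + 2 * (2 * B * (S.length * B)) := by
          gcongr
          · omega
          · exact Nat.le_mul_of_pos_right _ (by omega)
          · exact Nat.le_mul_of_pos_right _ (by omega)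
      _ = (96 + 4 * K + 4 * S.length) * (B * B) := by ring
      _ ≤ _ := Nat.mul_le_mul_left _ (h7.trans h6)
  · have h8 : B ≤ max (C.size ^ 2) (D.size ^ 2) := by
      rcases max_choice C.size D.size with h | h <;> rw [hB, h]
      · exact (Nat.le_self_pow (by omega) _).trans (le_max_left _ _)
      · exact (Nat.le_self_pow (by omega) _).trans (le_max_right _ _)
    omega

theorem mainTheorem4 (Γ : Set ThompsonG) (hfin : Γ.Finite)
    (hgen : Subgroup.closure Γ = ⊤) :
    ∃ c : ℕ, ∀ (m : ℕ) (g : Equiv.Perm (List.Vector Bool m)) (Cg Cginv : Circuit m m),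
      Cg.IsMinimumFor g → Cginv.IsMinimumFor g.symm →
      ∃ W : GroupWord Γ,
        (∀ x : List.Vector Bool m,
          W.value.toPEquiv (false :: x.toList) = some (false :: (g x).toList)) ∧
        (∀ y : List.Vector Bool m,
          (W.value⁻¹).toPEquiv (false :: y.toList) = some (false :: (g.symm y).toList)) ∧
        GroupWord.value (FreeGroup.invRev W) = W.value⁻¹ ∧
        W.value.Stabilizes false ∧ W.value.Stabilizes true ∧
        (W.value⁻¹).Stabilizes false ∧ (W.value⁻¹).Stabilizes true ∧
        W.length = (FreeGroup.invRev W).length ∧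
        W.length ≤ c * (Cg.size ^ 4 + Cginv.size ^ 4) ∧
        ∀ (i : ℕ) (hi : 1 ≤ i) (e : Bool), (Letter.trans i hi, e) ∈ W →
          i + 1 ≤ max (Cg.size ^ 2) (Cginv.size ^ 2) + 2 := by
  obtain ⟨c, hc⟩ := exists_word_bound hgen
  refine ⟨c, fun m g C D hC hD => ?_⟩
  obtain ⟨W, hlen, hsub, hW⟩ := hc m g C D hC.1 hD.1
  have hW' : ∀ y : List.Vector Bool m,
      (false :: (g.symm y).toList) ∈ (W.value⁻¹).toPEquiv (false :: y.toList) := fun y =>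
    ThompsonG.mem_inv.2 (by simpa using hW (g.symm y))
  have h0 : W.value.Stabilizes false := ThompsonG.stabilizes_of_forall_length (m := m)
    fun x hx => ⟨_, hW ⟨x, hx⟩⟩
  have h1 : (W.value⁻¹).Stabilizes false := ThompsonG.stabilizes_of_forall_length (m := m)
    fun x hx => ⟨_, hW' ⟨x, hx⟩⟩
  -- Each element stabilizes the half of strings beginning with 1 because its inverse stabilizes the
  -- other half.
  exact ⟨W, hW, hW', GroupWord.value_invRev W, h0, ThompsonG.stabilizes_not_of_stabilizes_inv h1,
    h1, ThompsonG.stabilizes_not_of_stabilizes_inv (b := false) (by rwa [inv_inv]),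
    FreeGroup.invRev_length.symm, hlen, hsub⟩
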